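/- **Setting.** Let $k,n\ge 1$. A quantum query algorithm $\mathcal A^{U_1,\dots,U_k}$ with query access to $n$-qubit unitaries $U_1,\dots,U_k$ is a circuit $G_q\mathcal O_q\cdots G_1\mathcal O_1G_0$ on some finite number of qubits, where the $G_i$ are unitaries independent of the oracles and each $\mathcal O_i$ is some $U_j$, or a controlled $U_j$, applied to specified qubits; it uses $Q_j$ queries to $U_j$ if exactly $Q_j$ of the $\mathcal O_i$ are queries to $U_j$. For a unit vector $|\psi\rangle\in(\mathbb C^2)^{\otimes n}$ put $R_\psi=I-2|\psi\rangle\langle\psi|$, and identify the unitary $\mathcal A^{R_{\psi_1},\dots,R_{\psi_k}}$ with the channel it induces by conjugation. A *$k$-samplizer* for $n$-qubit pure states assigns to every $\delta>0$ and every such $\mathcal A$ a quantum channel $\Phi=\Phi_{\delta,\mathcal A}$ (completely positive and trace preserving) and numbers $s_1,\dots,s_k\in\mathbb N$, none of which depends on the states $\psi_i$, such that for all $n$-qubit pure states $|\psi_1\rangle,\dots,|\psi_k\rangle$ the channel $$\mathsf{Samplize}_\delta\langle\mathcal A\rangle[\psi_1,\dots,\psi_k]:\ \rho\mapsto\Phi\bigl(\rho\otimes|\psi_1\rangle\langle\psi_1|^{\otimes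 s_1}\otimes\cdots\otimes|\psi_k\rangle\langle\psi_k|^{\otimes s_k}\bigr)$$ on the qubits of $\mathcal A$ satisfies $$\bigl\|\mathsf{Samplize}_\delta\langle\mathcal A\rangle[\psi_1,\dots,\psi_k]-\mathcal A^{R_{\psi_1},\dots,R_{\psi_k}}\bigr\|_\diamond\le\delta .$$ Here $\|\Psi\|_\diamond=\sup\{\|(\Psi\otimes\mathcal I_d)X\|_{\mathrm{tr}}:\|X\|_{\mathrm{tr}}\le1\}$ for $\Psi$ acting on $d\times d$ matrices. The samplizer has *sample complexity* $(S_1,\dots,S_k)$, where each $S_j$ takes values in $\mathbb N$, if, whenever $\mathcal A$ uses $Q_i$ queries to $U_i$ for each $i$, and $\delta>0$, the number $s_j$ of samples of $|\psi_j\rangle$ used is at most $S_j(Q_1,\dots,Q_k;\delta)$ for each $j$. **Theorem.** There are universal constants $c>0$ and $Q_0\in\mathbb N$ such that for all $k,n\ge1$, every $k$-samplizer for $n$-qubit pure states with sample complexity $(S_1,\dots,S_k)$, all $Q_1,\dots,Q_k\in\mathbb N$, every $\delta\in(0,1/9)$ and every $1\le j\le k$ with $Q_j\ge Q_0$, $$S_j(Q_1,\dots,Q_k;\delta)\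 \ge\ c\,\frac{Q_j^2}{\delta}.$$ -/

import Mathlib

open scoped Kronecker ComplexOrder

noncomputable section

namespace QSamplizer

/-! ### Linear algebra: trace norm, superoperators, channels, diamond norm -/

/-- The trace norm `tr |A| = tr √(Aᴴ A)`: the sum of the square roots of the eigenvalues of the
positive semidefinite matrix `Aᴴ A`, counted with multiplicity. -/
def traceNorm {ι : Type*} [Fintype ι] [DecidableEq ι] (A : Matrix ι ι ℂ) : ℝ :=
  ∑ i, Real.sqrt ((Matrix.isHermitian_conjTranspose_mul_self A).eigenvalues i)

/-- A superoperator: a linear map taking operators on `ℂ^ι` to operators on `ℂ^κ`. -/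
abbrev Superoperator (ι κ : Type*) : Type _ := Matrix ι ι ℂ →ₗ[ℂ] Matrix κ κ ℂ

/-- `Φ ⊗ 𝓘`, where `𝓘` is the identity superoperator on operators on `ℂ^ρ`: the map `Φ` is applied
to each block `(X (·, s) (·, t))` of `X`. -/
def amplify {ι κ : Type*} (ρ : Type*) (Φ : Superoperator ι κ)
    (X : Matrix (ι × ρ) (ι × ρ) ℂ) : Matrix (κ × ρ) (κ × ρ) ℂ :=
  Matrix.of fun p q => Φ (Matrix.of fun i j => X (i, p.2) (j, q.2)) p.1 q.1

/-- A quantum channel: a completely positive and trace-preserving superoperator. -/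
structure IsChannel {ι κ : Type*} [Fintype ι] [Fintype κ] (Φ : Superoperator ι κ) : Prop where
  completely_positive : ∀ (r : ℕ) (X : Matrix (ι × Fin r) (ι × Fin r) ℂ),
    X.PosSemidef → (amplify (Fin r) Φ X).PosSemidef
  trace_preserving : ∀ X : Matrix ι ι ℂ, (Φ X).trace = X.trace

/-- The diamond norm `sup {‖(Φ ⊗ 𝓘) X‖_tr : ‖X‖_tr ≤ 1}`, with an ancilla of the same dimension as
the system on which `Φ` acts. It takes values in `[0, ∞]`, so that the supremum always exists. -/
def diamondNorm {ι : Type*} [Fintype ι] [DecidableEq ι] (Φ : Superoperator ι ι) : ENNReal :=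
  ⨆ (X : Matrix (ι × ι) (ι × ι) ℂ) (_ : traceNorm X ≤ 1),
    ENNReal.ofReal (traceNorm (amplify ι Φ X))

/-- The superoperator `ρ ↦ V ρ Vᴴ`. -/
def conjugation {ι : Type*} [Fintype ι] (V : Matrix ι ι ℂ) : Superoperator ι ι where
  toFun ρ := V * ρ * V.conjTranspose
  map_add' ρ σ := by rw [Matrix.mul_add, Matrix.add_mul]
  map_smul' c ρ := by simp

/-! ### Qubits, pure states and reflections -/

/-- The computational basis of `n` qubits. -/
abbrev Bits (n : ℕ) : Type := Fin n → Fin 2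

/-- An `n`-qubit pure state: a unit vector in `(ℂ²)^{⊗ n}`. -/
structure PureState (n : ℕ) where
  amp : Bits n → ℂ
  norm_one : ∑ x, ‖amp x‖ ^ 2 = 1

/-- The reflection `R_ψ = I - 2 |ψ⟩⟨ψ|`. -/
def reflection {n : ℕ} (ψ : PureState n) : Matrix (Bits n) (Bits n) ℂ :=
  1 - (2 : ℂ) • Matrix.vecMulVec ψ.amp (star ψ.amp)

/-! ### Quantum query algorithms -/

/-- The operator `U` on `n` qubits, applied to the wires `e 0, …, e (n-1)` of an `m`-qubit register
(and the identity on the remaining wires). -/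
def onWires {n m : ℕ} (e : Fin n ↪ Fin m) (U : Matrix (Bits n) (Bits n) ℂ) :
    Matrix (Bits m) (Bits m) ℂ :=
  open Classical in
  Matrix.of fun x y =>
    if ∀ i, i ∉ Set.range e → x i = y i then U (fun a => x (e a)) (fun a => y (e a)) else 0

/-- The operator `U` on the wires given by `e`, controlled by the wire `c`: it acts as `U` where `c`
is in state `1` and as the identity where `c` is in state `0`. -/
def onWiresControlled {n m : ℕ} (e : Fin n ↪ Fin m) (c : Fin m) (U : Matrix (Bits n) (Bits n) ℂ) :
    Matrix (Bits m) (Bits m) ℂ :=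
  Matrix.of fun x y =>
    if x c = 1 then onWires e U x y else (1 : Matrix (Bits m) (Bits m) ℂ) x y

/-- One round of a query algorithm on `m` qubits with `k` oracles acting on `n` qubits each: a query
to one of the oracles (on specified wires, possibly controlled by a further wire), followed by a
unitary that does not depend on the oracles. -/
structure QueryRound (k n m : ℕ) where
  /-- which oracle is queried -/
  oracle : Fin k
  /-- the wires on which the oracle acts -/
  target : Fin n ↪ Fin m
  /-- `none` for a plain query, `some c` for a query controlled by the wire `c` -/
  control : Option {c : Fin m // c ∉ Set.range target}
  /-- the unitary that follows the query -/
  gate : Matrix.unitaryGroup (Bits m) ℂ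

/-- The operator of a round, when the oracles are `U 0, …, U (k-1)`. -/
def QueryRound.eval {k n m : ℕ} (r : QueryRound k n m)
    (U : Fin k → Matrix (Bits n) (Bits n) ℂ) : Matrix (Bits m) (Bits m) ℂ :=
  r.gate.val *
    (match r.control with
      | none => onWires r.target (U r.oracle)
      | some c => onWiresControlled r.target c.val (U r.oracle))

/-- A quantum query algorithm `𝒜^{U₁, …, U_k}` with query access to `k` unitary oracles on `n`
qubits: a quantum circuit `G_Q 𝒪_Q ⋯ G_1 𝒪_1 G_0` on some number of qubits, where each `G_q` is a
unitary independent of the oracles and each `𝒪_q` is a (plain or controlled) query. -/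
structure QueryAlgorithm (k n : ℕ) where
  /-- the number of qubits on which the circuit acts -/
  wires : ℕ
  /-- the unitary `G_0` before the first query -/
  initial : Matrix.unitaryGroup (Bits wires) ℂ
  /-- the rounds, in the order of execution -/
  rounds : List (QueryRound k n wires)

namespace QueryAlgorithm

/-- The number of queries to the `j`-th oracle. -/
def queries {k n : ℕ} (A : QueryAlgorithm k n) (j : Fin k) : ℕ :=
  A.rounds.countP fun r => decide (r.oracle = j)

/-- The operator implemented by the circuit when the oracles are `U 0, …, U (k-1)`. -/
def eval {k n : ℕ} (A : QueryAlgorithm k n) (U : Fin k → Matrix (Bits n) (Bits n) ℂ) :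
    Matrix (Bits A.wires) (Bits A.wires) ℂ :=
  A.rounds.foldl (fun V r => r.eval U * V) A.initial.val

/-- The channel `𝒜^{R_{ψ₁}, …, R_{ψ_k}}`. -/
def reflectionChannel {k n : ℕ} (A : QueryAlgorithm k n) (ψ : Fin k → PureState n) :
    Superoperator (Bits A.wires) (Bits A.wires) :=
  conjugation (A.eval fun j => reflection (ψ j))

end QueryAlgorithm

/-! ### Quantum sample algorithms -/

/-- Basis of a register that holds `s j` systems of `n` qubits for each `j`. -/
abbrev SampleIndex {k : ℕ} (n : ℕ) (s : Fin k → ℕ) : Type := (Σ j : Fin k, Fin (s j)) → Bits n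

/-- The vector `|ψ₁⟩^{⊗ s₁} ⊗ ⋯ ⊗ |ψ_k⟩^{⊗ s_k}`. -/
def samplesVector {k n : ℕ} (s : Fin k → ℕ) (ψ : Fin k → PureState n) : SampleIndex n s → ℂ :=
  fun x => ∏ p : (Σ j : Fin k, Fin (s j)), (ψ p.1).amp (x p)

/-- The density operator of `|ψ₁⟩^{⊗ s₁} ⊗ ⋯ ⊗ |ψ_k⟩^{⊗ s_k}`. -/
def samplesState {k n : ℕ} (s : Fin k → ℕ) (ψ : Fin k → PureState n) :
    Matrix (SampleIndex n s) (SampleIndex n s) ℂ :=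
  Matrix.vecMulVec (samplesVector s ψ) (star (samplesVector s ψ))

/-- A quantum sample algorithm on `m` qubits with sample access to `k` pure states of `n` qubits: it
uses `samples j` samples of the `j`-th state, and it is a quantum channel, chosen independently of
the states, from the joint system of the `m` qubits and all the samples to the `m` qubits. -/
structure SampleAlgorithm (k n m : ℕ) where
  samples : Fin k → ℕ
  map : Superoperator (Bits m × SampleIndex n samples) (Bits m)
  isChannel : IsChannel map

/-- The channel on `m` qubits that a sample algorithm implements when it is given samples of
`ψ₁, …, ψ_k`: `ρ ↦ Φ (ρ ⊗ ψ₁^{⊗ s₁} ⊗ ⋯ ⊗ ψ_k^{⊗ s_k})`. -/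
def SampleAlgorithm.run {k n m : ℕ} (B : SampleAlgorithm k n m) (ψ : Fin k → PureState n) :
    Superoperator (Bits m) (Bits m) where
  toFun ρ := B.map (ρ ⊗ₖ samplesState B.samples ψ)
  map_add' ρ σ := by rw [Matrix.add_kronecker, map_add]
  map_smul' c ρ := by rw [Matrix.smul_kronecker, map_smul]; rfl

/-! ### Samplizers -/

/-- A converter from query algorithms, with a precision parameter, to sample algorithms on the same
qubits. -/
abbrev Converter (k n : ℕ) : Type :=
  ℝ → (A : QueryAlgorithm k n) → SampleAlgorithm k n A.wires

/-- A `k`-samplizer for `n`-qubit pure states: for every precision `δ > 0`, query algorithm `𝒜` and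
pure states `ψ₁, …, ψ_k`, the sample algorithm `Samplize_δ⟨𝒜⟩` run on samples of these states is
`δ`-close in diamond norm to `𝒜^{R_{ψ₁}, …, R_{ψ_k}}`. -/
def IsSamplizer {k n : ℕ} (Samplize : Converter k n) : Prop :=
  ∀ δ : ℝ, 0 < δ → ∀ (A : QueryAlgorithm k n) (ψ : Fin k → PureState n),
    diamondNorm ((Samplize δ A).run ψ - A.reflectionChannel ψ) ≤ ENNReal.ofReal δ

/-- The converter has sample complexity `(S₁, …, S_k)`: if `𝒜` makes `Q_j` queries to `U_j` for each
`j`, then `Samplize_δ⟨𝒜⟩` uses (at most) `S_j(Q₁, …, Q_k; δ)` samples of `ψ_j` for each `j`. -/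
def HasSampleComplexity {k n : ℕ} (Samplize : Converter k n)
    (S : Fin k → (Fin k → ℕ) → ℝ → ℕ) : Prop :=
  ∀ δ : ℝ, 0 < δ → ∀ (A : QueryAlgorithm k n) (Q : Fin k → ℕ), (∀ i, A.queries i = Q i) →
    ∀ j, (Samplize δ A).samples j ≤ S j Q δ

end QSamplizer

end

/-!
Running a samplized algorithm many times turns it into a test that distinguishes two nearby states,
and such a test needs many samples.

Let `ψ_φ = cos φ |0…0⟩ + sin φ |1…1⟩` and let `A` follow every query by the fixed reflection `R_{ψ_0}`.
With all oracles but `j` equal to `R_{ψ_0}`, their queries cancel, and with `R_{ψ_θ}` as oracle `j` the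
algorithm rotates the plane of the `ψ_φ` by the angle `2 θ Q_j` (up to sign), see
`reflection_mul_reflection_pow_mulVec` and `reflectionAlgorithm_eval`. Applied `m` times to `|0…0⟩`,
it yields `|0…0⟩` for `θ = 0` and an orthogonal state for `θ = π / (4 m Q_j)`. The samplized channel,
used `m` times, does the same up to an error `m δ` in the probability of the outcome `|0…0⟩`
(`norm_expectation_iterate_sub_le`). With `m = ⌊1 / (9 δ)⌋` this error is at most `1 / 9`.

On the other hand the `m` uses consume `m s_j` samples of `ψ_0` or of `ψ_θ`, whose overlap is
`(cos θ) ^ (m s_j)`. To compare the two runs, the channel is iterated on the `2 × 2` block operator that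
carries the two outputs on its diagonal and, off the diagonal, the result of feeding in
`|ψ_0⟩⟨ψ_θ|` instead of a state (`SampleAlgorithm.jointIterate`). Complete positivity keeps this
operator positive, and trace preservation makes the trace of the off-diagonal block equal to the
overlap (`SampleAlgorithm.trace_block_jointIterate`), while positivity bounds that trace by
`2 √(m δ) ≤ 2 / 3` (`norm_trace_block_le`). Hence `(cos θ) ^ (m s_j) ≤ 2 / 3`, so `m s_j θ ^ 2 ≥ 2 / 3`,
and `s_j` is at least of order `m Q_j ^ 2`, that is `Q_j ^ 2 / δ`.
-/

open scoped Matrix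

namespace QSamplizer

/-! ### Trace norm and expectation values -/

theorem star_dotProduct_self {ι : Type*} [Fintype ι] (v : ι → ℂ) :
    star v ⬝ᵥ v = ((∑ i, ‖v i‖ ^ 2 : ℝ) : ℂ) := by
  push_cast
  exact Finset.sum_congr rfl fun i _ => Complex.conj_mul' _

/-- The Cauchy–Schwarz inequality, in terms of dot products. -/
theorem normSq_star_dotProduct_le {ι : Type*} [Fintype ι] (v w : ι → ℂ) :
    ‖star v ⬝ᵥ w‖ ^ 2 ≤ (star v ⬝ᵥ v).re * (star w ⬝ᵥ w).re := by
  have h := norm_inner_le_norm (𝕜 := ℂ) (WithLp.toLp 2 v) (WithLp.toLp 2 w)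
  have hv : ∀ u : ι → ℂ, (star u ⬝ᵥ u).re = ‖WithLp.toLp 2 u‖ ^ 2 := fun u => by
    rw [← inner_self_eq_norm_sq (𝕜 := ℂ), EuclideanSpace.inner_toLp_toLp, dotProduct_comm]
    rfl
  rw [EuclideanSpace.inner_toLp_toLp, dotProduct_comm] at h
  rw [hv, hv, ← mul_pow]
  exact pow_le_pow_left₀ (norm_nonneg _) h 2

theorem traceNorm_eq_trace {ι : Type*} [Fintype ι] [DecidableEq ι] {A : Matrix ι ι ℂ}
    (hA : A.PosSemidef) : traceNorm A = A.trace.re := by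
  set U : Matrix ι ι ℂ := hA.1.eigenvectorUnitary.val with hU
  have hUU : Uᴴ * U = 1 := Matrix.mem_unitaryGroup_iff'.mp hA.1.eigenvectorUnitary.2
  have hsp : A = U * Matrix.diagonal (fun i => (hA.1.eigenvalues i : ℂ)) * Uᴴ := by
    conv_lhs => rw [hA.1.spectral_theorem]
    rfl
  have hsq : Aᴴ * A = U * Matrix.diagonal (fun i => ((hA.1.eigenvalues i ^ 2 : ℝ) : ℂ)) * Uᴴ := by
    rw [hA.1.eq]
    conv_lhs => rw [hsp]
    calc _ = U * Matrix.diagonal (fun i => (hA.1.eigenvalues i : ℂ)) * (Uᴴ * U) *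
          Matrix.diagonal (fun i => (hA.1.eigenvalues i : ℂ)) * Uᴴ := by
            simp only [Matrix.mul_assoc]
      _ = _ := by
        rw [hUU, Matrix.mul_one, Matrix.mul_assoc U, Matrix.diagonal_mul_diagonal]
        simp [sq]
  have hroots := (Matrix.isHermitian_conjTranspose_mul_self A).roots_charpoly_eq_eigenvalues
  have hchar : (Aᴴ * A).charpoly =
      (Matrix.diagonal (fun i => ((hA.1.eigenvalues i ^ 2 : ℝ) : ℂ))).charpoly := by
    rw [hsq, Matrix.charpoly_mul_comm, ← Matrix.mul_assoc, hUU, Matrix.one_mul]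
  rw [hchar, Matrix.charpoly_diagonal, Polynomial.roots_prod _ _
    (Finset.prod_ne_zero_iff.mpr fun _ _ => Polynomial.X_sub_C_ne_zero _)] at hroots
  simp only [Polynomial.roots_X_sub_C, Multiset.bind_singleton] at hroots
  have hsum := congrArg (fun s : Multiset ℂ => (s.map fun z => Real.sqrt z.re).sum) hroots
  simp only [Multiset.map_map, Function.comp_def] at hsum
  have htr := congrArg Complex.re hA.1.trace_eq_sum_eigenvalues
  simp only [Complex.coe_algebraMap, Complex.ofReal_re, Complex.re_sum] at htr hsum
  rw [htr, traceNorm]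
  refine hsum.symm.trans (Finset.sum_congr rfl fun i _ => ?_)
  simp [Real.sqrt_sq (hA.eigenvalues_nonneg i)]

/-- The modulus of an expectation value is at most the operator norm, hence at most the trace
norm. -/
theorem norm_expectation_le_traceNorm {ι : Type*} [Fintype ι] [DecidableEq ι]
    (Y : Matrix ι ι ℂ) (v : ι → ℂ) (hv : star v ⬝ᵥ v = 1) :
    ‖star v ⬝ᵥ (Y *ᵥ v)‖ ≤ traceNorm Y := by
  have hH := Matrix.isHermitian_conjTranspose_mul_self Y
  have hT : 0 ≤ traceNorm Y := Finset.sum_nonneg fun _ _ => Real.sqrt_nonneg _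
  have hle : ∀ i, hH.eigenvalues i ≤ traceNorm Y ^ 2 := fun i => by
    rw [← Real.sqrt_le_left hT]
    exact Finset.single_le_sum (f := fun i => Real.sqrt (hH.eigenvalues i))
      (fun _ _ => Real.sqrt_nonneg _) (Finset.mem_univ i)
  set U : Matrix ι ι ℂ := hH.eigenvectorUnitary.val with hU
  have hUU : U * Uᴴ = 1 := Matrix.mem_unitaryGroup_iff.mp hH.eigenvectorUnitary.2
  have hsp : Yᴴ * Y = U * Matrix.diagonal (fun i => (hH.eigenvalues i : ℂ)) * Uᴴ := by
    conv_lhs => rw [hH.spectral_theorem]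
    rfl
  set w := Uᴴ *ᵥ v with hw
  have hstar : star w = star v ᵥ* U := by simp [hw, Matrix.star_mulVec]
  have hww : star w ⬝ᵥ w = 1 := by
    rw [hstar, hw, ← Matrix.dotProduct_mulVec, Matrix.mulVec_mulVec, hUU, Matrix.one_mulVec, hv]
  have hYv : star (Y *ᵥ v) ⬝ᵥ (Y *ᵥ v) = ∑ i, ((hH.eigenvalues i * ‖w i‖ ^ 2 : ℝ) : ℂ) := by
    rw [Matrix.star_mulVec, ← Matrix.dotProduct_mulVec, Matrix.mulVec_mulVec]
    conv_lhs => rw [hsp]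
    rw [← Matrix.mulVec_mulVec, ← Matrix.mulVec_mulVec, ← hw, Matrix.dotProduct_mulVec, ← hstar]
    refine Finset.sum_congr rfl fun i _ => ?_
    rw [Matrix.mulVec_diagonal]
    push_cast
    rw [← Complex.conj_mul']
    simp only [Pi.star_apply, RCLike.star_def]
    ring
  have hw1 : ∑ i, ‖w i‖ ^ 2 = 1 := by
    rw [star_dotProduct_self] at hww
    exact_mod_cast hww
  have hcs := normSq_star_dotProduct_le v (Y *ᵥ v)
  rw [hv, hYv, ← Complex.ofReal_sum, Complex.ofReal_re, Complex.one_re, one_mul] at hcs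
  refine le_of_sq_le_sq (hcs.trans ?_) hT
  calc _ ≤ ∑ i, traceNorm Y ^ 2 * ‖w i‖ ^ 2 :=
        Finset.sum_le_sum fun i _ => mul_le_mul_of_nonneg_right (hle i) (sq_nonneg _)
    _ = _ := by rw [← Finset.mul_sum, hw1, mul_one]

/-- Diamond distance bounds the error of every outcome probability on a density operator without
ancilla. -/
theorem norm_expectation_le_of_diamondNorm_le {ι : Type*} [Fintype ι] [DecidableEq ι]
    {Φ : Superoperator ι ι} {δ : ℝ} (hδ : 0 ≤ δ) (hΦ : diamondNorm Φ ≤ ENNReal.ofReal δ)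
    {ρ : Matrix ι ι ℂ} (hρ : ρ.PosSemidef) (htr : ρ.trace = 1)
    (v : ι → ℂ) (hv : star v ⬝ᵥ v = 1) :
    ‖star v ⬝ᵥ (Φ ρ *ᵥ v)‖ ≤ δ := by
  obtain ⟨e⟩ : Nonempty ι := by
    by_contra h
    rw [not_nonempty_iff] at h
    simp [Matrix.trace] at htr
  -- The ancilla is put into the basis state `e`.
  set X : Matrix (ι × ι) (ι × ι) ℂ :=
    Matrix.of fun p q => if p.2 = e ∧ q.2 = e then ρ p.1 q.1 else 0 with hX
  set B : Matrix ι (ι × ι) ℂ := Matrix.of fun i p => if p.2 = e ∧ p.1 = i then 1 else 0 with hB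
  have hXB : X = Bᴴ * ρ * B := by
    ext ⟨i, s⟩ ⟨j, t⟩
    by_cases hs : s = e <;> by_cases ht : t = e <;>
      simp [hX, hB, Matrix.mul_apply, Matrix.conjTranspose_apply, hs, ht]
  have hXpsd : X.PosSemidef := hXB ▸ hρ.conjTranspose_mul_mul_same B
  have hXtr : X.trace = 1 := by
    rw [← htr]
    simp [hX, Matrix.trace, Fintype.sum_prod_type]
  have h1 : traceNorm X ≤ 1 := by rw [traceNorm_eq_trace hXpsd, hXtr, Complex.one_re]
  have h2 : traceNorm (amplify ι Φ X) ≤ δ := by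
    rw [← ENNReal.ofReal_le_ofReal_iff hδ]
    exact (le_iSup₂_of_le (f := fun (X : Matrix (ι × ι) (ι × ι) ℂ) (_ : traceNorm X ≤ 1) =>
      ENNReal.ofReal (traceNorm (amplify ι Φ X))) X h1 le_rfl).trans hΦ
  refine le_trans (le_of_eq ?_) ((norm_expectation_le_traceNorm (amplify ι Φ X)
    (fun p => if p.2 = e then v p.1 else 0) ?_).trans h2)
  · have hblock : (Matrix.of fun i j => X (i, e) (j, e)) = ρ := by ext; simp [hX]
    congr 1
    simp [dotProduct, Matrix.mulVec, Fintype.sum_prod_type, amplify, hblock, apply_ite]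
  · rw [← hv]
    simp [dotProduct, Fintype.sum_prod_type, apply_ite]

/-! ### Distinguishing two states by a basis measurement -/

/-- The block `(a, b)` of an operator on `ℂ^ι ⊗ ℂ^κ`, with `κ` as the block index. -/
def block {ι κ : Type*} (M : Matrix (ι × κ) (ι × κ) ℂ) (a b : κ) : Matrix ι ι ℂ :=
  Matrix.of fun x y => M (x, a) (y, b)

/-- If `[[ρ, C], [Cᴴ, σ]]` is positive semidefinite, then `|tr C|` is small whenever a single
measurement outcome `e` tells the density operators `ρ` and `σ` apart: this is one half of the
Fuchs–van de Graaf comparison, with `|tr C|` in place of the fidelity. -/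
theorem norm_trace_block_le {ι : Type*} [Fintype ι] [DecidableEq ι]
    {M : Matrix (ι × Fin 2) (ι × Fin 2) ℂ} (hM : M.PosSemidef)
    (h0 : (block M 0 0).trace = 1) (h1 : (block M 1 1).trace = 1) (e : ι) {ε : ℝ}
    (hp : 1 - ε ≤ (block M 0 0 e e).re) (hq : (block M 1 1 e e).re ≤ ε) :
    ‖(block M 0 1).trace‖ ≤ 2 * Real.sqrt ε := by
  set p : ι → ℝ := fun x => (M (x, 0) (x, 0)).re with hpdef
  set q : ι → ℝ := fun x => (M (x, 1) (x, 1)).re with hqdef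
  have hre : ∀ z, 0 ≤ (M z z).re ∧ M z z = ((M z z).re : ℂ) := fun z => by
    have h := Complex.nonneg_iff.mp (hM.diag_nonneg (i := z))
    exact ⟨h.1, Complex.ext rfl (by simp [← h.2])⟩
  have hp0 : ∀ x, 0 ≤ p x := fun x => (hre _).1
  have hq0 : ∀ x, 0 ≤ q x := fun x => (hre _).1
  have hpsum : ∑ x, p x = 1 := by
    have := congrArg Complex.re h0
    simpa [Matrix.trace, block] using this
  have hqsum : ∑ x, q x = 1 := by
    have := congrArg Complex.re h1
    simpa [Matrix.trace, block] using this
  -- The principal minors on `{(x, 0), (x, 1)}` are nonnegative.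
  have hminor : ∀ x, ‖M (x, 0) (x, 1)‖ ≤ Real.sqrt (p x) * Real.sqrt (q x) := fun x => by
    have hd := (hM.submatrix fun a : Fin 2 => (x, a)).det_nonneg
    have hherm : M (x, 1) (x, 0) = star (M (x, 0) (x, 1)) := (hM.1.apply _ _).symm
    rw [Matrix.det_fin_two] at hd
    simp only [Matrix.submatrix_apply] at hd
    rw [hherm, (hre (x, 0)).2, (hre (x, 1)).2, RCLike.star_def, Complex.mul_conj'] at hd
    rw [← Real.sqrt_mul (hp0 x)]
    refine Real.le_sqrt_of_sq_le ?_
    have := (Complex.nonneg_iff.mp hd).1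
    norm_cast at this
    exact sub_nonneg.mp this
  have hpe : p e ≤ 1 := hpsum ▸ Finset.single_le_sum (fun x _ => hp0 x) (Finset.mem_univ e)
  have hsplit : ∀ f : ι → ℝ, ∑ x, f x = f e + ∑ x ∈ Finset.univ.erase e, f x := fun f =>
    (Finset.add_sum_erase _ f (Finset.mem_univ e)).symm
  calc ‖(block M 0 1).trace‖ ≤ ∑ x, Real.sqrt (p x) * Real.sqrt (q x) :=
        (norm_sum_le _ _).trans (Finset.sum_le_sum fun x _ => hminor x)
    _ = Real.sqrt (p e) * Real.sqrt (q e) +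
          ∑ x ∈ Finset.univ.erase e, Real.sqrt (p x) * Real.sqrt (q x) := hsplit _
    _ ≤ 1 * Real.sqrt ε + Real.sqrt ε * 1 := by
        refine add_le_add (mul_le_mul (Real.sqrt_le_one.mpr hpe) (Real.sqrt_le_sqrt hq)
          (Real.sqrt_nonneg _) zero_le_one) ?_
        refine (Real.sum_sqrt_mul_sqrt_le _ hp0 hq0).trans ?_
        have hp' := hsplit p
        have hq' := hsplit q
        refine mul_le_mul (Real.sqrt_le_sqrt ?_) (Real.sqrt_le_one.mpr ?_)
          (Real.sqrt_nonneg _) (Real.sqrt_nonneg _)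
        · have : 1 - ε ≤ p e := hp
          linarith
        · linarith [hq0 e]
    _ = 2 * Real.sqrt ε := by ring

/-! ### Iterating a sample algorithm on several families of states at once -/

section Iteration

variable {k n m : ℕ}

/-- The operator whose block `(a, b)` is obtained from `ρ` by `t` steps
`X ↦ Φ (X ⊗ |Ψ_a⟩⟨Ψ_b|)`, where `Ψ_a` is the vector of samples of the family `ψ a`. The diagonal
blocks are the outputs of the iterated sample algorithm; the others record the overlaps of the
samples consumed. -/
def SampleAlgorithm.jointIterate (B : SampleAlgorithm k n m) {r : ℕ}
    (ψ : Fin r → Fin k → PureState n) (ρ : Matrix (Bits m) (Bits m) ℂ) :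
    ℕ → Matrix (Bits m × Fin r) (Bits m × Fin r) ℂ
  | 0 => Matrix.of fun p q => ρ p.1 q.1
  | t + 1 => Matrix.of fun p q =>
      B.map (block (B.jointIterate ψ ρ t) p.2 q.2 ⊗ₖ
        Matrix.vecMulVec (samplesVector B.samples (ψ p.2))
          (star (samplesVector B.samples (ψ q.2)))) p.1 q.1

/-- Tensoring the block `(a, b)` with `|s_a⟩⟨s_b|` preserves positivity: it is a congruence by the
map that contracts the new register with `s_a` in block `a`. -/
theorem posSemidef_kronecker_vecMulVec {ι κ σ : Type*} [Fintype ι] [Fintype κ] [Fintype σ]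
    {M : Matrix (ι × κ) (ι × κ) ℂ}
    (hM : M.PosSemidef) (s : κ → σ → ℂ) :
    (Matrix.of fun p q : (ι × σ) × κ =>
      (block M p.2 q.2 ⊗ₖ Matrix.vecMulVec (s p.2) (star (s q.2))) p.1 q.1).PosSemidef := by
  classical
  convert hM.conjTranspose_mul_mul_same
    (Matrix.of fun (p : ι × κ) (q : (ι × σ) × κ) =>
      if p.1 = q.1.1 then if p.2 = q.2 then star (s q.2 q.1.2) else 0 else 0) using 1
  ext ⟨⟨i, x⟩, a⟩ ⟨⟨j, y⟩, b⟩
  simp [Matrix.mul_apply, Matrix.conjTranspose_apply, Fintype.sum_prod_type, block,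
    Matrix.vecMulVec_apply, apply_ite]
  ring

theorem SampleAlgorithm.posSemidef_jointIterate (B : SampleAlgorithm k n m) {r : ℕ}
    (ψ : Fin r → Fin k → PureState n) {ρ : Matrix (Bits m) (Bits m) ℂ} (hρ : ρ.PosSemidef)
    (t : ℕ) : (B.jointIterate ψ ρ t).PosSemidef := by
  induction t with
  | zero => exact hρ.submatrix Prod.fst
  | succ t ih =>
    exact B.isChannel.completely_positive r _ (posSemidef_kronecker_vecMulVec ih fun a =>
      samplesVector B.samples (ψ a))

theorem SampleAlgorithm.block_jointIterate_self (B : SampleAlgorithm k n m) {r : ℕ}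
    (ψ : Fin r → Fin k → PureState n) (ρ : Matrix (Bits m) (Bits m) ℂ) (a : Fin r) (t : ℕ) :
    block (B.jointIterate ψ ρ t) a a = (B.run (ψ a))^[t] ρ := by
  induction t with
  | zero => rfl
  | succ t ih => rw [Function.iterate_succ_apply', ← ih]; rfl

/-- Since `Φ` preserves traces, the trace of an off-diagonal block is multiplied by the overlap of
the samples at each step; no purification of `Φ` is needed. -/
theorem SampleAlgorithm.trace_block_jointIterate (B : SampleAlgorithm k n m) {r : ℕ}
    (ψ : Fin r → Fin k → PureState n) (ρ : Matrix (Bits m) (Bits m) ℂ) (a b : Fin r) (t : ℕ) :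
    (block (B.jointIterate ψ ρ t) a b).trace =
      ρ.trace * (star (samplesVector B.samples (ψ b)) ⬝ᵥ samplesVector B.samples (ψ a)) ^ t := by
  induction t with
  | zero => rw [pow_zero, mul_one]; rfl
  | succ t ih =>
    have : block (B.jointIterate ψ ρ (t + 1)) a b = B.map (block (B.jointIterate ψ ρ t) a b ⊗ₖ
        Matrix.vecMulVec (samplesVector B.samples (ψ a))
          (star (samplesVector B.samples (ψ b)))) := rfl
    rw [this, B.isChannel.trace_preserving, Matrix.trace_kronecker, ih, Matrix.trace_vecMulVec,
      dotProduct_comm, pow_succ]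
    ring

theorem star_samplesVector_dotProduct (s : Fin k → ℕ) (ψ φ : Fin k → PureState n) :
    star (samplesVector s ψ) ⬝ᵥ samplesVector s φ =
      ∏ i, (star (ψ i).amp ⬝ᵥ (φ i).amp) ^ s i := by
  have h : ∏ p : (Σ j : Fin k, Fin (s j)), ∑ y, star ((ψ p.1).amp y) * (φ p.1).amp y =
      star (samplesVector s ψ) ⬝ᵥ samplesVector s φ := by
    rw [Finset.prod_univ_sum, Fintype.piFinset_univ]
    refine Finset.sum_congr rfl fun x _ => ?_
    rw [Finset.prod_mul_distrib]
    simp [samplesVector]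
  rw [← h, Fintype.prod_sigma]
  simp [dotProduct]

end Iteration

/-! ### Accumulation of errors -/

theorem PureState.star_amp_dotProduct_self {n : ℕ} (ψ : PureState n) :
    star ψ.amp ⬝ᵥ ψ.amp = 1 := by
  rw [star_dotProduct_self, ψ.norm_one, Complex.ofReal_one]

theorem star_mulVec_dotProduct_self {ι : Type*} [Fintype ι] [DecidableEq ι] {V : Matrix ι ι ℂ}
    (hV : V ∈ Matrix.unitaryGroup ι ℂ) (v : ι → ℂ) :
    star (Vᴴ *ᵥ v) ⬝ᵥ (Vᴴ *ᵥ v) = star v ⬝ᵥ v := by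
  have h : V * Vᴴ = 1 := Matrix.mem_unitaryGroup_iff.mp hV
  rw [Matrix.star_mulVec, Matrix.conjTranspose_conjTranspose, ← Matrix.dotProduct_mulVec,
    Matrix.mulVec_mulVec, h, Matrix.one_mulVec]

/-- Errors add up when an approximation `Φ` of the conjugation by a unitary `V` is iterated. The
exact channel is moved onto the measured vector, `v ↦ Vᴴ v`, so contractivity of `Φ` is not
used. -/
theorem norm_expectation_iterate_sub_le {ι : Type*} [Fintype ι] [DecidableEq ι]
    {Φ : Superoperator ι ι} {V : Matrix ι ι ℂ} (hV : V ∈ Matrix.unitaryGroup ι ℂ)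
    {δ : ℝ} (hδ : 0 ≤ δ) (hΦ : diamondNorm (Φ - conjugation V) ≤ ENNReal.ofReal δ)
    {ρ : Matrix ι ι ℂ} (hρ : ∀ t, (Φ^[t] ρ).PosSemidef ∧ (Φ^[t] ρ).trace = 1) (t : ℕ)
    (v : ι → ℂ) (hv : star v ⬝ᵥ v = 1) :
    ‖star v ⬝ᵥ (Φ^[t] ρ *ᵥ v) - star v ⬝ᵥ ((conjugation V)^[t] ρ *ᵥ v)‖ ≤ t * δ := by
  induction t generalizing v with
  | zero => simp
  | succ t ih =>
    rw [Function.iterate_succ_apply', Function.iterate_succ_apply']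
    have hconj : ∀ σ : Matrix ι ι ℂ, star v ⬝ᵥ (conjugation V σ *ᵥ v) =
        star (Vᴴ *ᵥ v) ⬝ᵥ (σ *ᵥ (Vᴴ *ᵥ v)) := fun σ => by
      rw [Matrix.star_mulVec, Matrix.conjTranspose_conjTranspose, ← Matrix.dotProduct_mulVec,
        Matrix.mulVec_mulVec, Matrix.mulVec_mulVec]
      rfl
    have h1 := norm_expectation_le_of_diamondNorm_le hδ hΦ (hρ t).1 (hρ t).2 v hv
    have h2 := ih (Vᴴ *ᵥ v) (by rw [star_mulVec_dotProduct_self hV, hv])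
    rw [← hconj, ← hconj] at h2
    rw [LinearMap.sub_apply, Matrix.sub_mulVec, dotProduct_sub] at h1
    calc _ ≤ _ := norm_sub_le_norm_sub_add_norm_sub _ (star v ⬝ᵥ (conjugation V (Φ^[t] ρ) *ᵥ v)) _
      _ ≤ δ + t * δ := add_le_add h1 h2
      _ = _ := by push_cast; ring

theorem conjugation_iterate_vecMulVec {ι : Type*} [Fintype ι] [DecidableEq ι] (V : Matrix ι ι ℂ)
    (u : ι → ℂ) (t : ℕ) :
    (conjugation V)^[t] (Matrix.vecMulVec u (star u)) =
      Matrix.vecMulVec (V ^ t *ᵥ u) (star (V ^ t *ᵥ u)) := by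
  induction t with
  | zero => simp
  | succ t ih =>
    rw [Function.iterate_succ_apply', ih, pow_succ', ← Matrix.mulVec_mulVec, Matrix.star_mulVec V]
    change V * _ * Vᴴ = _
    rw [Matrix.mul_vecMulVec, Matrix.vecMulVec_mul]

/-! ### Reflections in a real plane -/

/-- The vector `cos φ |0…0⟩ + sin φ |1…1⟩`. -/
noncomputable def planeVector (n : ℕ) (φ : ℝ) : Bits n → ℂ :=
  Pi.single 0 (Real.cos φ : ℂ) + Pi.single 1 (Real.sin φ : ℂ)

theorem star_planeVector (n : ℕ) (φ : ℝ) : star (planeVector n φ) = planeVector n φ := by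
  simp only [planeVector, star_add, Pi.star_single, RCLike.star_def, Complex.conj_ofReal]

theorem planeVector_apply_zero {n : ℕ} (hn : 1 ≤ n) (φ : ℝ) : planeVector n φ 0 = Real.cos φ := by
  have h : (0 : Bits n) ≠ 1 := fun h => by simpa using congrFun h ⟨0, hn⟩
  simp [planeVector, h]

theorem planeVector_apply_one {n : ℕ} (hn : 1 ≤ n) (φ : ℝ) : planeVector n φ 1 = Real.sin φ := by
  have h : (1 : Bits n) ≠ 0 := fun h => by simpa using congrFun h ⟨0, hn⟩
  simp [planeVector, h]

theorem planeVector_dotProduct {n : ℕ} (hn : 1 ≤ n) (φ χ : ℝ) :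
    planeVector n φ ⬝ᵥ planeVector n χ = Real.cos (φ - χ) := by
  rw [planeVector, add_dotProduct, single_dotProduct, single_dotProduct,
    planeVector_apply_zero hn, planeVector_apply_one hn, Real.cos_sub]
  push_cast
  rfl

/-- The state `cos φ |0…0⟩ + sin φ |1…1⟩`; for `n = 0` the two basis vectors would coincide. -/
noncomputable def planeState {n : ℕ} (hn : 1 ≤ n) (φ : ℝ) : PureState n where
  amp := planeVector n φ
  norm_one := by
    have h := star_dotProduct_self (planeVector n φ)
    rw [star_planeVector, planeVector_dotProduct hn, sub_self, Real.cos_zero] at h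
    exact_mod_cast h.symm

theorem reflection_mulVec {n : ℕ} (ψ : PureState n) (x : Bits n → ℂ) :
    reflection ψ *ᵥ x = x - (2 * (star ψ.amp ⬝ᵥ x)) • ψ.amp := by
  rw [reflection, Matrix.sub_mulVec, Matrix.one_mulVec, Matrix.smul_mulVec,
    Matrix.vecMulVec_mulVec, op_smul_eq_smul, smul_smul]

theorem reflection_mul_self {n : ℕ} (ψ : PureState n) : reflection ψ * reflection ψ = 1 := by
  refine Matrix.ext_of_mulVec_single fun i => ?_
  rw [← Matrix.mulVec_mulVec, Matrix.one_mulVec, reflection_mulVec, reflection_mulVec,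
    dotProduct_sub, dotProduct_smul, ψ.star_amp_dotProduct_self]
  module

theorem reflection_mem_unitaryGroup {n : ℕ} (ψ : PureState n) :
    reflection ψ ∈ Matrix.unitaryGroup (Bits n) ℂ := by
  have h : (reflection ψ)ᴴ = reflection ψ := by
    simp [reflection, Matrix.conjTranspose_vecMulVec]
  rw [Matrix.mem_unitaryGroup_iff, Matrix.star_eq_conjTranspose, h, reflection_mul_self]

theorem reflection_planeState_mulVec {n : ℕ} (hn : 1 ≤ n) (θ φ : ℝ) :
    reflection (planeState hn θ) *ᵥ planeVector n φ = -planeVector n (2 * θ - φ) := by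
  have h : planeVector n φ + planeVector n (2 * θ - φ) =
      ((2 * Real.cos (θ - φ) : ℝ) : ℂ) • planeVector n θ := by
    have hc : Real.cos φ + Real.cos (2 * θ - φ) = 2 * Real.cos (θ - φ) * Real.cos θ := by
      have h1 := Real.cos_sub θ (θ - φ)
      have h2 := Real.cos_add θ (θ - φ)
      ring_nf at h1 h2 ⊢
      linarith
    have hs : Real.sin φ + Real.sin (2 * θ - φ) = 2 * Real.cos (θ - φ) * Real.sin θ := by
      have h1 := Real.sin_sub θ (θ - φ)
      have h2 := Real.sin_add θ (θ - φ)
      ring_nf at h1 h2 ⊢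
      linarith
    rw [planeVector, planeVector, planeVector, add_add_add_comm, ← Pi.single_add, ← Pi.single_add,
      smul_add, ← Pi.single_smul, ← Pi.single_smul, smul_eq_mul, smul_eq_mul]
    norm_cast
    rw [hc, hs]
  rw [reflection_mulVec]
  change _ - (2 * (star (planeVector n θ) ⬝ᵥ planeVector n φ)) • planeVector n θ = _
  rw [star_planeVector, planeVector_dotProduct hn, sub_eq_iff_eq_add]
  push_cast at h ⊢
  rw [← h]
  abel

/-- The product of two reflections is a rotation by twice the angle between them. -/
theorem reflection_mul_reflection_pow_mulVec {n : ℕ} (hn : 1 ≤ n) (θ φ : ℝ) (N : ℕ) :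
    (reflection (planeState hn 0) * reflection (planeState hn θ)) ^ N *ᵥ planeVector n φ =
      planeVector n (φ - N * (2 * θ)) := by
  induction N with
  | zero => simp
  | succ N ih =>
    rw [pow_succ', ← Matrix.mulVec_mulVec, ih, ← Matrix.mulVec_mulVec,
      reflection_planeState_mulVec, Matrix.mulVec_neg, reflection_planeState_mulVec, neg_neg]
    congr 1
    push_cast
    ring

/-! ### The query algorithm -/

/-- The round on `n` qubits that queries the oracle `i` on all qubits and then applies `R_ψ`. -/
noncomputable def reflectionRound {k n : ℕ} (ψ : PureState n) (i : Fin k) : QueryRound k n n where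
  oracle := i
  target := Function.Embedding.refl _
  control := none
  gate := ⟨reflection ψ, reflection_mem_unitaryGroup ψ⟩

/-- The algorithm on `n` qubits that goes through the oracles in `l`, each query being followed by
`R_ψ`. -/
noncomputable def reflectionAlgorithm {k n : ℕ} (ψ : PureState n) (l : List (Fin k)) :
    QueryAlgorithm k n where
  wires := n
  initial := 1
  rounds := l.map (reflectionRound ψ)

theorem reflectionAlgorithm_queries {k n : ℕ} (ψ : PureState n) (l : List (Fin k)) (i : Fin k) :
    (reflectionAlgorithm ψ l).queries i = l.count i := by
  rw [QueryAlgorithm.queries, reflectionAlgorithm, List.countP_map]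
  exact List.countP_congr fun a _ => decide_eq_true_iff.trans beq_iff_eq.symm

theorem reflectionRound_eval {k n : ℕ} (ψ : PureState n) (i : Fin k)
    (U : Fin k → Matrix (Bits n) (Bits n) ℂ) :
    (reflectionRound ψ i).eval U = reflection ψ * U i := by
  have h : onWires (Function.Embedding.refl (Fin n)) (U i) = U i := by
    ext x y
    simp [onWires]
  simp only [QueryRound.eval, reflectionRound, h]

/-- Queries to oracles other than `j` cancel with the gates that follow them. -/
theorem reflectionAlgorithm_eval {k n : ℕ} {ψ : PureState n} (l : List (Fin k)) {j : Fin k}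
    {φ : Fin k → PureState n} (hφ : ∀ i, i ≠ j → φ i = ψ) :
    (reflectionAlgorithm ψ l).eval (fun i => reflection (φ i)) =
      (reflection ψ * reflection (φ j)) ^ l.count j := by
  have h : ∀ (l : List (Fin k)) (V : Matrix (Bits n) (Bits n) ℂ),
      (l.map (reflectionRound ψ)).foldl
        (fun V r => r.eval (fun i => reflection (φ i)) * V) V =
      (reflection ψ * reflection (φ j)) ^ l.count j * V := by
    intro l
    induction l with
    | nil => simp
    | cons i l ih =>
      intro V
      rw [List.map_cons, List.foldl_cons, ih, reflectionRound_eval]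
      by_cases hi : i = j
      · subst hi
        simp only [List.count_cons_self, pow_succ, Matrix.mul_assoc]
      · rw [List.count_cons_of_ne hi, hφ i hi, reflection_mul_self, Matrix.one_mul]
  exact (h l 1).trans (Matrix.mul_one _)

theorem exists_list_count_eq {ι : Type*} [Fintype ι] [DecidableEq ι] (Q : ι → ℕ) :
    ∃ l : List ι, ∀ i, l.count i = Q i := by
  refine ⟨(∑ i, Multiset.replicate (Q i) i).toList, fun i => ?_⟩
  rw [← Multiset.coe_count, Multiset.coe_toList, Multiset.count_sum']
  simp [Multiset.count_replicate]

/-! ### The lower bound -/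

theorem two_thirds_le_mul_sq_of_cos_pow_le {θ : ℝ} (hθ : 0 ≤ θ) (hθ' : θ ≤ Real.pi / 2) {N : ℕ}
    (h : Real.cos θ ^ N ≤ 2 / 3) : 2 / 3 ≤ N * θ ^ 2 := by
  have hc : 0 ≤ Real.cos θ := Real.cos_nonneg_of_neg_pi_div_two_le_of_le (by linarith) hθ'
  have h1 := one_add_mul_le_pow (a := Real.cos θ - 1) (by linarith) N
  rw [add_sub_cancel] at h1
  have h2 := mul_le_mul_of_nonneg_left (Real.one_sub_sq_div_two_le_cos (x := θ))
    (Nat.cast_nonneg (α := ℝ) N)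
  linarith

/-- A sample algorithm that approximates the rotation by `2 θ N` up to `δ` gives, after `m` uses, a
test that separates the angles `0` and `θ`, so the overlap of the `m · s_j` samples consumed is
small. -/
theorem cos_pow_le_of_diamondNorm_le {k n : ℕ} (hn : 1 ≤ n) (j : Fin k) (N : ℕ)
    (B : SampleAlgorithm k n n) {δ : ℝ} (hδ : 0 ≤ δ)
    (hB : ∀ φ : Fin k → PureState n, (∀ i, i ≠ j → φ i = planeState hn 0) → diamondNorm
      (B.run φ - conjugation ((reflection (planeState hn 0) * reflection (φ j)) ^ N)) ≤
        ENNReal.ofReal δ)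
    (m : ℕ) {θ : ℝ} (hθ : m * N * (2 * θ) = Real.pi / 2) :
    Real.cos θ ^ (m * B.samples j) ≤ 2 * Real.sqrt (m * δ) := by
  -- Only the state of the oracle `j` differs between the two families.
  set angle : Fin 2 → ℝ := ![0, θ] with hangle
  set ψ : Fin 2 → Fin k → PureState n :=
    fun a i => planeState hn (if i = j then angle a else 0) with hψ
  set u := planeVector n 0 with hu
  have huu : star u ⬝ᵥ u = 1 := by
    rw [hu, star_planeVector, planeVector_dotProduct hn, sub_self, Real.cos_zero,
      Complex.ofReal_one]
  set ρ := Matrix.vecMulVec u (star u) with hρ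
  have hρpsd : ρ.PosSemidef := Matrix.posSemidef_vecMulVec_self_star u
  have hρtr : ρ.trace = 1 := by rw [hρ, Matrix.trace_vecMulVec, dotProduct_comm, huu]
  set M := B.jointIterate ψ ρ m with hM
  have htr : ∀ a t, ((B.run (ψ a))^[t] ρ).trace = 1 := fun a t => by
    rw [← B.block_jointIterate_self, B.trace_block_jointIterate, hρtr,
      star_samplesVector_dotProduct]
    simp [PureState.star_amp_dotProduct_self]
  have hpsd : ∀ a t, ((B.run (ψ a))^[t] ρ).PosSemidef := fun a t => by
    rw [← B.block_jointIterate_self]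
    exact (B.posSemidef_jointIterate ψ hρpsd t).submatrix fun x => (x, a)
  -- The probability of finding `|0…0⟩` after `m` uses is nearly that of the exact rotation.
  have hestimate : ∀ a, |(block M a a 0 0).re -
      Real.cos (m * N * (2 * angle a)) ^ 2| ≤ m * δ := fun a => by
    set W := reflection (planeState hn 0) * reflection (planeState hn (angle a)) with hW
    have hWu : W ∈ Matrix.unitaryGroup (Bits n) ℂ :=
      mul_mem (reflection_mem_unitaryGroup _) (reflection_mem_unitaryGroup _)
    have hd := hB (ψ a) fun i hi => by simp only [hψ, if_neg hi]
    have hψj : ψ a j = planeState hn (angle a) := by simp only [hψ, if_true]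
    rw [hψj] at hd
    have h := norm_expectation_iterate_sub_le (pow_mem hWu _) hδ hd
      (fun t => ⟨hpsd a t, htr a t⟩) m u huu
    rw [← B.block_jointIterate_self, conjugation_iterate_vecMulVec, ← pow_mul,
      reflection_mul_reflection_pow_mulVec hn] at h
    have hu0 : u = Pi.single 0 1 := by simp [hu, planeVector]
    refine le_trans (le_trans (le_of_eq ?_) (Complex.abs_re_le_norm _)) h
    rw [hu0]
    simp [Matrix.vecMulVec_apply, star_planeVector, planeVector_apply_zero hn, hM,
      -Complex.ofReal_cos]
    rw [sq, mul_comm (m : ℝ)]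
  have h0 := hestimate 0
  have h1 := hestimate 1
  simp only [hangle, Matrix.cons_val_zero, Matrix.cons_val_one, mul_zero, Real.cos_zero, hθ,
    Real.cos_pi_div_two] at h0 h1
  rw [abs_le] at h0 h1
  have key := norm_trace_block_le (ε := m * δ) (B.posSemidef_jointIterate ψ hρpsd m)
    (by rw [B.block_jointIterate_self, htr]) (by rw [B.block_jointIterate_self, htr]) 0
    (by linarith) (by linarith)
  rw [B.trace_block_jointIterate, hρtr, one_mul, star_samplesVector_dotProduct,
    Finset.prod_eq_single j] at key
  · refine le_trans (le_trans (le_abs_self _) (le_of_eq ?_)) key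
    simp only [hψ, planeState, star_planeVector, planeVector_dotProduct hn]
    simp [hangle, ← pow_mul, mul_comm, -Complex.ofReal_cos]
  · intro i _ hi
    simp [hψ, hi, PureState.star_amp_dotProduct_self]
  · simp

end QSamplizer

theorem theorem7p3 :
    ∃ c : ℝ, 0 < c ∧ ∃ Q₀ : ℕ,
      ∀ (k n : ℕ), 1 ≤ n →
      ∀ (Samplize : QSamplizer.Converter k n) (S : Fin k → (Fin k → ℕ) → ℝ → ℕ),
        QSamplizer.IsSamplizer Samplize →
        QSamplizer.HasSampleComplexity Samplize S →
        ∀ (Q : Fin k → ℕ) (δ : ℝ), 0 < δ → δ < 1 / 9 →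
          ∀ j : Fin k, Q₀ ≤ Q j → c * ((Q j : ℝ) ^ 2 / δ) ≤ (S j Q δ : ℝ) := by
  refine ⟨1 / 18, by norm_num, 1, fun k n hn Samplize S hSam hS Q δ hδ hδ' j hQ => ?_⟩
  obtain ⟨l, hl⟩ := QSamplizer.exists_list_count_eq Q
  set A := QSamplizer.reflectionAlgorithm (QSamplizer.planeState hn 0) l with hA
  set s := (Samplize δ A).samples j with hs
  have hsS : s ≤ S j Q δ :=
    hS δ hδ A Q (fun i => (QSamplizer.reflectionAlgorithm_queries _ l i).trans (hl i)) j
  -- `m` uses of the samplized channel have total error at most `1 / 9`, and `m ≥ 1 / (18 δ)`.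
  set m := ⌊1 / (9 * δ)⌋₊ with hm
  have hinv : 1 < 1 / (9 * δ) := by rw [lt_div_iff₀ (by positivity)]; linarith
  have hm1 : 1 ≤ m := Nat.le_floor (by exact_mod_cast hinv.le)
  have hmδ : m * δ ≤ 1 / 9 := by
    have := Nat.floor_le (zero_le_one.trans hinv.le)
    rw [le_div_iff₀ (by positivity)] at this
    linarith
  have hmlow : 1 / (18 * δ) ≤ m := by
    have h1 := Nat.lt_floor_add_one (1 / (9 * δ))
    have h2 : (1 : ℝ) ≤ m := by exact_mod_cast hm1
    have h3 : 1 / (9 * δ) = 2 * (1 / (18 * δ)) := by field_simp; norm_num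
    linarith
  have hm0 : (0 : ℝ) < m := by exact_mod_cast hm1
  have hQ1 : (1 : ℝ) ≤ Q j := by exact_mod_cast hQ
  have hmQ : (1 : ℝ) ≤ m * Q j := by exact_mod_cast Nat.mul_pos hm1 hQ
  -- `m` runs of `A` rotate by `2 θ m Q_j = π / 2`, that is, onto an orthogonal state.
  set θ := Real.pi / (4 * (m * Q j)) with hθ
  have hθ0 : 0 ≤ θ := by positivity
  have hθ1 : θ ≤ Real.pi / 2 :=
    div_le_div_of_nonneg_left Real.pi_pos.le two_pos (by linarith)
  have hcos := QSamplizer.cos_pow_le_of_diamondNorm_le hn j (Q j) (Samplize δ A) hδ.le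
    (fun φ hφ => by
      have h := hSam δ hδ A φ
      rw [QSamplizer.QueryAlgorithm.reflectionChannel,
        QSamplizer.reflectionAlgorithm_eval l hφ, hl] at h
      exact h) m (θ := θ) (by rw [hθ]; field_simp; norm_num)
  have hsqrt : Real.sqrt (m * δ) ≤ 1 / 3 := Real.sqrt_le_iff.mpr ⟨by norm_num, by linarith⟩
  have hbound := QSamplizer.two_thirds_le_mul_sq_of_cos_pow_le hθ0 hθ1 (hcos.trans (by linarith))
  have hpi : Real.pi ^ 2 ≤ 10 := by nlinarith [Real.pi_lt_d2, Real.pi_pos]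
  have hsm : (Q j : ℝ) ^ 2 * m ≤ s := by
    have h : ((m * s : ℕ) : ℝ) * θ ^ 2 * (16 * (m * Q j) ^ 2) = m * (s * Real.pi ^ 2) := by
      rw [hθ]; push_cast; field_simp; norm_num
    have h1 := mul_le_mul_of_nonneg_right hbound (by positivity : 0 ≤ 16 * (m * (Q j : ℝ)) ^ 2)
    rw [h] at h1
    have h2 : (s : ℝ) * Real.pi ^ 2 ≤ s * 10 := by gcongr
    have h3 : m * (2 / 3 * 16 * (m * (Q j : ℝ) ^ 2)) ≤ m * (s * 10) := by nlinarith
    have h4 := le_of_mul_le_mul_left h3 hm0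
    have h5 : 0 ≤ m * (Q j : ℝ) ^ 2 := by positivity
    linarith
  calc (1 / 18 : ℝ) * ((Q j : ℝ) ^ 2 / δ) = (Q j : ℝ) ^ 2 * (1 / (18 * δ)) := by
        field_simp
    _ ≤ (Q j : ℝ) ^ 2 * m := by gcongr
    _ ≤ s := hsm
    _ ≤ S j Q δ := by exact_mod_cast hsS
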